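/- For an integer $m$ and an integer $k$ let $p_{m,k}(x)=\binom{m}{k}x^k(1-x)^{m-k}$ if $0\le k\le m$, and $p_{m,k}(x)=0$ if $k<0$ or $k>m$. For $n\in\mathbb N$ put \begin{align*} \tilde b(x,n)&=\tfrac12 n^2x^4-(n^2+3n+16)x^3+\left(\tfrac12n^2+\tfrac{29}{6}n+\tfrac{89}{3}\right)x^2-\left(\tfrac{53}{3}+\tfrac{11}{6}n\right)x+\tfrac{10}{3},\\ \tilde d(x,n)&=-2n^2x^4+(4n^2+6n+32)x^3-\left(2n^2+\tfrac{28}{3}n+\tfrac{161}{3}\right)x^2+\left(\tfrac{80}{3}+\tfrac{10}{3}n\right)x-\tfrac{10}{3},\\ \tilde e(x,n)&=3n^2\,(x(1-x))^2, \end{align*} \begin{align*} p_{n,k}^{M,3}(x)={}&\tilde b(x,n)\,p_{n-4,k}(x)+\tilde d(x,n)\,p_{n-4,k-1}(x)+\tilde e(x,n)\,p_{n-4,k-2}(x)\\ &+\tilde d(1-x,n)\,p_{n-4,k-3}(x)+\tilde b(1-x,n)\,p_{n-4,k-4}(x), \end{align*} and, for $f$ continuous on $[0,1]$ and $x\in[0,1]$,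 $$\tilde D_n^{M,3}(f;x)=(n+1)\sum_{k=0}^n p_{n,k}^{M,3}(x)\int_0^1 p_{n,k}(t)f(t)\,dt .$$ Theorem. If $f\in C^{10}[0,1]$ (real-valued) and $x\in[0,1]$, then $$\tilde D_n^{M,3}(f;x)-f(x)=O\!\left(\frac1{n^3}\right)\qquad (n\to\infty),$$ that is, there are a constant $C$ and an index $N$ (which may depend on $f$ and $x$) such that $|\tilde D_n^{M,3}(f;x)-f(x)|\le C/n^3$ for all $n\ge N$. -/

import Mathlib

open Filter Asymptotics

noncomputable section

namespace DurrmeyerIII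

/-- The Bernstein basis `p_{m,k}(x) = C(m,k) x^k (1-x)^(m-k)` for `0 ≤ k ≤ m`, and `0` if `k < 0` or
`k > m`. Both indices are integers, so that `p_{n-4,k-j}` involves no truncated subtraction. -/
def p (m k : ℤ) (x : ℝ) : ℝ :=
  if 0 ≤ k ∧ k ≤ m then (bernsteinPolynomial ℝ m.toNat k.toNat).eval x else 0

/-- The weights `p_{n,k}^{M,3}(x)` built from coefficient functions `b(x,n)`, `d(x,n)`, `e(x,n)`. -/
def weight (b d e : ℝ → ℕ → ℝ) (n : ℕ) (k : ℤ) (x : ℝ) : ℝ :=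
  b x n * p ((n : ℤ) - 4) k x + d x n * p ((n : ℤ) - 4) (k - 1) x
    + e x n * p ((n : ℤ) - 4) (k - 2) x
    + d (1 - x) n * p ((n : ℤ) - 4) (k - 3) x + b (1 - x) n * p ((n : ℤ) - 4) (k - 4) x

/-- The operator `D_n^{M,3}(f;x) = (n+1) ∑_{k=0}^n p_{n,k}^{M,3}(x) ∫_0^1 p_{n,k}(t) f(t) dt`
with coefficient functions `b`, `d`, `e`. -/
def durrmeyer3 (b d e : ℝ → ℕ → ℝ) (n : ℕ) (f : ℝ → ℝ) (x : ℝ) : ℝ :=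
  ((n : ℝ) + 1) * ∑ k ∈ Finset.range (n + 1),
    weight b d e n (k : ℤ) x * ∫ t in (0 : ℝ)..1, p (n : ℤ) (k : ℤ) t * f t

/-- The function `b̃(x,n) = b̃₄(n) x⁴ + b̃₃(n) x³ + b̃₂(n) x² + b̃₁(n) x + b̃₀(n)`. -/
def bTilde (x : ℝ) (n : ℕ) : ℝ :=
  (1 / 2 * (n : ℝ) ^ 2) * x ^ 4
    + (-(n : ℝ) ^ 2 - 3 * (n : ℝ) - 16) * x ^ 3
    + (1 / 2 * (n : ℝ) ^ 2 + 29 / 6 * (n : ℝ) + 89 / 3) * x ^ 2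
    + (-(53 / 3) - 11 / 6 * (n : ℝ)) * x
    + 10 / 3

/-- The function `d̃(x,n) = d̃₄(n) x⁴ + d̃₃(n) x³ + d̃₂(n) x² + d̃₁(n) x + d̃₀(n)`. -/
def dTilde (x : ℝ) (n : ℕ) : ℝ :=
  (-2 * (n : ℝ) ^ 2) * x ^ 4
    + (4 * (n : ℝ) ^ 2 + 6 * (n : ℝ) + 32) * x ^ 3
    + (-2 * (n : ℝ) ^ 2 - 28 / 3 * (n : ℝ) - 161 / 3) * x ^ 2
    + (80 / 3 + 10 / 3 * (n : ℝ)) * x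
    + -(10 / 3)

/-- The function `ẽ(x,n) = ẽ₀(n) (x(1-x))²`. -/
def eTilde (x : ℝ) (n : ℕ) : ℝ :=
  (3 * (n : ℝ) ^ 2) * (x * (1 - x)) ^ 2

/-- The third-order operator `D̃_n^{M,3}`. -/
def durrmeyerTilde3 (n : ℕ) (f : ℝ → ℝ) (x : ℝ) : ℝ :=
  durrmeyer3 bTilde dTilde eTilde n f x

end DurrmeyerIII

end

namespace DurrmeyerIII

open Polynomial

/-! Taylor expansion at `x` reduces the claim to the moments of `(t-x)^s` for `s < 10`, plus a
remainder dominated by `(t-x)^10`. The operator combines five shifted Durrmeyer operators with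
coefficients of size `n^2`, and the `s`-th moment of each is `O(n^{-⌈s/2⌉})`. Termwise bounds thus
lose a factor `n^2`: harmless for the remainder, fatal for `5 ≤ s ≤ 8`. The cancellation shows up in
forward differences `Δ` in the shift: the combination becomes `∑ c_r Δ^r` with `c_r = O(n^{⌊r/2⌋})`
(`sum_tildeCoeff_mul_shiftedMoment`), while `Δ^r` of the moment, cleared of its denominator of order
`n^s`, is `O(n^{⌊(s-r)/2⌋})` (`polyGrowth_momentDiff`). Nothing is lost, so the moments are
`O(n^{-3})` for `s ≥ 5`. Those with `s ≤ 4` are computed exactly. -/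

/-! ### Moment polynomials and their recurrences -/

/-- The polynomial in `x` equal, up to the factor `(n+2)⋯(n+s+1)`, to
`(n+1) ∫₀¹ p_{n,k}(t) (t-x)^s dt`. -/
noncomputable def kernelMoment (n k : ℝ) : ℕ → ℝ[X]
  | 0 => 1
  | 1 => C k - C n * X + (1 - 2 * X)
  | s + 2 => (C k - C n * X + ((s : ℝ[X]) + 2) * (1 - 2 * X)) * kernelMoment n k (s + 1)
      + ((s : ℝ[X]) + 1) * (C n + (s : ℝ[X]) + 2) * (X * (1 - X)) * kernelMoment n k s

/-- Reflects `d/dx (t-x)^(s+1) = -(s+1)(t-x)^s`; the factor `n+s+2` is the ratio of the two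
normalisations. -/
theorem derivative_kernelMoment_succ (n k : ℝ) (s : ℕ) :
    derivative (kernelMoment n k (s + 1))
      = -(((s : ℝ[X]) + 1) * (C n + (s : ℝ[X]) + 2) * kernelMoment n k s) := by
  induction s using Nat.twoStepInduction with
  | zero =>
    simp [kernelMoment]
    ring
  | one =>
    simp [kernelMoment, derivative_mul]
    ring
  | more s ih1 ih2 =>
    rw [kernelMoment]
    simp only [derivative_mul, derivative_add, derivative_sub, derivative_C, derivative_X,
      derivative_natCast, derivative_one, derivative_ofNat]
    rw [ih2, show s + 1 + 1 = s + 2 from rfl, kernelMoment, ih1]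
    push_cast
    ring

/-- The polynomial in `x` equal, up to the factor `(n+2)⋯(n+s+1)`, to
`(n+1) ∑ l, p_{n-4,l}(x) ∫₀¹ p_{n,l+j}(t) (t-x)^s dt`. -/
noncomputable def shiftedMoment (n : ℝ) (j : ℕ) : ℕ → ℝ[X]
  | 0 => 1
  | 1 => (j : ℝ[X]) - 4 * X + (1 - 2 * X)
  | s + 2 => X * (1 - X) * derivative (shiftedMoment n j (s + 1))
      + ((j : ℝ[X]) - 4 * X + ((s : ℝ[X]) + 2) * (1 - 2 * X)) * shiftedMoment n j (s + 1)
      + 2 * ((s : ℝ[X]) + 1) * (C n + (s : ℝ[X]) + 2) * (X * (1 - X)) * shiftedMoment n j s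

theorem X_mul_one_sub_X_mul_derivative_bernstein (m l : ℕ) :
    X * (1 - X) * derivative (bernsteinPolynomial ℝ m l)
      = ((l : ℝ[X]) - (m : ℝ[X]) * X) * bernsteinPolynomial ℝ m l := by
  rcases le_or_gt l m with h | h
  · obtain ⟨r, rfl⟩ := Nat.exists_eq_add_of_le h
    simp only [bernsteinPolynomial, Nat.add_sub_cancel_left]
    rcases l with _ | l <;> rcases r with _ | r <;>
      simp [derivative_mul, derivative_pow] <;> ring
  · simp [bernsteinPolynomial.eq_zero_of_lt ℝ h]

/-- With `n = m+4` and `k = l+j`, `k - nx = (l - mx) + (j - 4x)`, and `l - mx` acts on the basis as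
`x(1-x) d/dx`. Moving that derivative outside the sum also differentiates the kernel moment, which
doubles the last term of the recurrence. -/
theorem sum_bernstein_mul_kernelMoment (m j s : ℕ) :
    ∑ l ∈ Finset.range (m + 1),
      bernsteinPolynomial ℝ m l * kernelMoment ((m : ℝ) + 4) ((l : ℝ) + j) s
      = shiftedMoment ((m : ℝ) + 4) j s := by
  have key : ∀ (A : ℝ[X]) (J : ℕ → ℝ[X]),
      ∑ l ∈ Finset.range (m + 1), bernsteinPolynomial ℝ m l *
        ((C ((l : ℝ) + j) - C ((m : ℝ) + 4) * X + A) * J l)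
      = X * (1 - X) * derivative (∑ l ∈ Finset.range (m + 1), bernsteinPolynomial ℝ m l * J l)
        - X * (1 - X) * (∑ l ∈ Finset.range (m + 1), bernsteinPolynomial ℝ m l * derivative (J l))
        + ((j : ℝ[X]) - 4 * X + A) *
          ∑ l ∈ Finset.range (m + 1), bernsteinPolynomial ℝ m l * J l := by
    intro A J
    simp only [derivative_sum, derivative_mul, Finset.mul_sum, ← Finset.sum_sub_distrib,
      ← Finset.sum_add_distrib]
    refine Finset.sum_congr rfl fun l _ => ?_
    have h := X_mul_one_sub_X_mul_derivative_bernstein m l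
    simp only [C_add, C_eq_natCast, C_ofNat]
    linear_combination -(J l) * h
  induction s using Nat.twoStepInduction with
  | zero => simp [kernelMoment, shiftedMoment, bernsteinPolynomial.sum]
  | one =>
    have h := key (1 - 2 * X) (fun _ => 1)
    simp only [mul_one, bernsteinPolynomial.sum, derivative_one, mul_zero,
      Finset.sum_const_zero] at h
    simp only [kernelMoment, shiftedMoment, h]
    ring
  | more s ih1 ih2 =>
    have h := key (((s : ℝ[X]) + 2) * (1 - 2 * X))
      (fun l => kernelMoment ((m : ℝ) + 4) ((l : ℝ) + j) (s + 1))
    simp only [kernelMoment, shiftedMoment, mul_add (bernsteinPolynomial ℝ m _),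
      Finset.sum_add_distrib, h, ih2]
    simp only [derivative_kernelMoment_succ]
    rw [← ih1]
    have e : ∀ c : ℝ[X], ∑ l ∈ Finset.range (m + 1), bernsteinPolynomial ℝ m l *
        (c * kernelMoment ((m : ℝ) + 4) ((l : ℝ) + j) s)
        = c * ∑ l ∈ Finset.range (m + 1), bernsteinPolynomial ℝ m l *
          kernelMoment ((m : ℝ) + 4) ((l : ℝ) + j) s := by
      intro c
      rw [Finset.mul_sum]
      exact Finset.sum_congr rfl fun l _ => by ring
    simp only [mul_neg, Finset.sum_neg_distrib, e]
    ring

/-! ### Differences in the shift and their growth in `n` -/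

/-- Iterated forward differences of `shiftedMoment` in the shift. -/
noncomputable def momentDiff (n : ℝ) (s : ℕ) : ℕ → ℕ → ℝ[X]
  | 0, j => shiftedMoment n j s
  | r + 1, j => momentDiff n s r (j + 1) - momentDiff n s r j

/-- Discrete Leibniz rule: the recurrence is affine in `j` with slope 1, so differencing it adds
just one term, of difference order `r - 1`. -/
theorem momentDiff_add_two (n : ℝ) (s r j : ℕ) :
    momentDiff n (s + 2) r j = X * (1 - X) * derivative (momentDiff n (s + 1) r j)
      + ((j : ℝ[X]) - 4 * X + ((s : ℝ[X]) + 2) * (1 - 2 * X)) * momentDiff n (s + 1) r j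
      + (r : ℝ[X]) * momentDiff n (s + 1) (r - 1) (j + 1)
      + 2 * ((s : ℝ[X]) + 1) * (C n + (s : ℝ[X]) + 2) * (X * (1 - X)) * momentDiff n s r j := by
  induction r generalizing j with
  | zero => simp [momentDiff, shiftedMoment]
  | succ r ih =>
    -- At `r = 0` the truncated index `r - 1` is harmless because of the factor `r`.
    have hr : (r : ℝ[X]) * (momentDiff n (s + 1) (r - 1) (j + 2)
        - momentDiff n (s + 1) (r - 1) (j + 1)) = r * momentDiff n (s + 1) r (j + 1) := by
      rcases r with _ | r
      · simp
      · simp [momentDiff]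
    simp only [momentDiff, ih, derivative_sub, Nat.add_sub_cancel]
    push_cast
    linear_combination hr

theorem momentDiff_zero_succ (n : ℝ) (r j : ℕ) : momentDiff n 0 (r + 1) j = 0 := by
  induction r generalizing j with
  | zero => simp [momentDiff, shiftedMoment]
  | succ r ih => rw [momentDiff, ih, ih, sub_zero]

theorem momentDiff_one_one (n : ℝ) (j : ℕ) : momentDiff n 1 1 j = 1 := by
  simp [momentDiff, shiftedMoment]

theorem momentDiff_one_add_two (n : ℝ) (r j : ℕ) : momentDiff n 1 (r + 2) j = 0 := by
  induction r generalizing j with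
  | zero => rw [momentDiff, momentDiff_one_one, momentDiff_one_one, sub_self]
  | succ r ih => rw [momentDiff, ih, ih, sub_zero]

/-- The sequence of polynomials `F` and all its derivatives are pointwise `O(n^d)`. -/
def PolyGrowth (d : ℤ) (F : ℕ → ℝ[X]) : Prop :=
  ∀ (k : ℕ) (x : ℝ), (fun n => (derivative^[k] (F n)).eval x) =O[atTop] fun n => (n : ℝ) ^ d

namespace PolyGrowth

variable {d d' : ℤ} {F G : ℕ → ℝ[X]}

theorem eval (h : PolyGrowth d F) (x : ℝ) :
    (fun n => (F n).eval x) =O[atTop] fun n => (n : ℝ) ^ d := h 0 x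

theorem zero (d : ℤ) : PolyGrowth d (fun _ => 0) := fun k x => by simp [isBigO_zero]

theorem add (hF : PolyGrowth d F) (hG : PolyGrowth d G) : PolyGrowth d (fun n => F n + G n) :=
  fun k x => by
    simpa only [iterate_map_add, eval_add] using (hF k x).add (hG k x)

theorem derivative (hF : PolyGrowth d F) : PolyGrowth d (fun n => Polynomial.derivative (F n)) :=
  fun k x => by simpa only [← Function.iterate_succ_apply] using hF (k + 1) x

theorem const_mul (P : ℝ[X]) (hF : PolyGrowth d F) : PolyGrowth d (fun n => P * F n) :=
  fun k x => by
    simp only [iterate_derivative_mul, eval_finsetSum, eval_smul, eval_mul]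
    refine IsBigO.fun_sum fun i _ => ?_
    simp only [nsmul_eq_mul]
    exact ((hF i x).const_mul_left _).const_mul_left _

theorem C_mul {g : ℕ → ℝ} (hg : g =O[atTop] fun n => (n : ℝ) ^ d) (hF : PolyGrowth d' F) :
    PolyGrowth (d + d') (fun n => C (g n) * F n) := fun k x => by
  simp only [iterate_derivative_C_mul, eval_mul, eval_C]
  refine (hg.mul (hF k x)).congr' EventuallyEq.rfl ?_
  filter_upwards [eventually_ne_atTop 0] with n hn
  rw [zpow_add₀ (Nat.cast_ne_zero.mpr hn)]

theorem const (P : ℝ[X]) (hd : 0 ≤ d) : PolyGrowth d (fun _ => P) := fun k x => by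
  obtain ⟨e, rfl⟩ := Int.eq_ofNat_of_zero_le hd
  refine IsBigO.trans (g := fun _ => (1 : ℝ)) (isBigO_const_const _ one_ne_zero _) ?_
  refine IsBigO.of_bound 1 ?_
  filter_upwards [eventually_ge_atTop 1] with n hn
  have : (1 : ℝ) ≤ (n : ℝ) ^ e := one_le_pow₀ (by exact_mod_cast hn)
  simpa using this.trans (le_abs_self _)

end PolyGrowth

theorem isBigO_natCast_add_const (c : ℝ) :
    (fun n : ℕ => (n : ℝ) + c) =O[atTop] fun n => (n : ℝ) ^ (1 : ℤ) := by
  simp only [zpow_one]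
  refine (isBigO_refl _ _).add (IsBigO.of_bound |c| ?_)
  filter_upwards [eventually_ge_atTop 1] with n hn
  have : (1 : ℝ) ≤ n := by exact_mod_cast hn
  simpa using le_mul_of_one_le_right (abs_nonneg c) this

/-- Raising `s` by two costs one power of `n`, and each difference saves half a power. Control of
all derivatives is needed because the recurrence differentiates; negative `d` occurs where the
differences vanish. -/
theorem polyGrowth_momentDiff (s : ℕ) : ∀ (r j : ℕ) (d : ℤ), (s : ℤ) ≤ r + 2 * d + 1 →
    PolyGrowth d (fun n => momentDiff n s r j) := by
  induction s using Nat.twoStepInduction with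
  | zero =>
    intro r j d h
    rcases r with _ | r
    · exact PolyGrowth.const _ (by push_cast at h; omega)
    · simp only [momentDiff_zero_succ]
      exact PolyGrowth.zero d
  | one =>
    intro r j d h
    rcases r with _ | _ | r
    · exact PolyGrowth.const _ (by push_cast at h; omega)
    · simp only [zero_add, momentDiff_one_one]
      exact PolyGrowth.const _ (by push_cast at h; omega)
    · simp only [momentDiff_one_add_two]
      exact PolyGrowth.zero d
  | more s ih1 ih2 =>
    intro r j d h
    simp only [momentDiff_add_two]
    push_cast at h
    have h1 := ih2 r j d (by push_cast; omega)
    have h3 : PolyGrowth d (fun n => (r : ℝ[X]) * momentDiff n (s + 1) (r - 1) (j + 1)) := by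
      rcases r with _ | r
      · simpa using PolyGrowth.zero d
      · exact (ih2 r (j + 1) d (by push_cast at h ⊢; omega)).const_mul _
    have h4 := ((ih1 r j (d - 1) (by omega)).C_mul
      (isBigO_natCast_add_const ((s : ℝ) + 2))).const_mul
        (2 * ((s : ℝ[X]) + 1) * (X * (1 - X)))
    rw [show 1 + (d - 1) = d by ring] at h4
    refine (((h1.derivative.const_mul _).add (h1.const_mul _)).add h3).add ?_
    convert h4 using 2 with n
    simp only [C_add, C_eq_natCast, C_ofNat]
    ring

/-! ### Integrals of Bernstein polynomials against powers -/

theorem integral_eval_derivative (P : ℝ[X]) :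
    ∫ t in (0 : ℝ)..1, (derivative P).eval t = P.eval 1 - P.eval 0 :=
  intervalIntegral.integral_eq_sub_of_hasDerivAt (fun t _ => P.hasDerivAt t)
    (Polynomial.continuous _).continuousOn.intervalIntegrable

theorem integral_bernstein (n k : ℕ) (h : k ≤ n) :
    ((n : ℝ) + 1) * ∫ t in (0 : ℝ)..1, (bernsteinPolynomial ℝ n k).eval t = 1 := by
  induction k with
  | zero =>
    have h := integral_eval_derivative (bernsteinPolynomial ℝ (n + 1) 0)
    rw [bernsteinPolynomial.derivative_zero] at h
    simp only [bernsteinPolynomial.eval_at_0, bernsteinPolynomial.eval_at_1, eval_mul, eval_neg,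
      eval_natCast, intervalIntegral.integral_const_mul, Nat.add_sub_cancel] at h
    push_cast at h
    simp at h
    linarith
  | succ k ih =>
    have h' := integral_eval_derivative (bernsteinPolynomial ℝ (n + 1) (k + 1))
    rw [bernsteinPolynomial.derivative_succ] at h'
    simp only [bernsteinPolynomial.eval_at_0, bernsteinPolynomial.eval_at_1, eval_mul, eval_sub,
      eval_natCast, intervalIntegral.integral_const_mul, Nat.add_sub_cancel] at h'
    rw [intervalIntegral.integral_sub (Polynomial.continuous _).continuousOn.intervalIntegrable
      (Polynomial.continuous _).continuousOn.intervalIntegrable, if_neg (by omega),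
      if_neg (by omega)] at h'
    have := ih (by omega)
    push_cast at h'
    linarith

theorem integral_bernstein_mul_pow_succ (n k s : ℕ) (x : ℝ) :
    ((n : ℝ) + 2 + s) * ∫ t in (0 : ℝ)..1, (bernsteinPolynomial ℝ n k).eval t * (t - x) ^ (s + 1)
      = ((k : ℝ) - n * x + (s + 1) * (1 - 2 * x)) *
          (∫ t in (0 : ℝ)..1, (bernsteinPolynomial ℝ n k).eval t * (t - x) ^ s)
        + s * (x * (1 - x)) *
          ∫ t in (0 : ℝ)..1, (bernsteinPolynomial ℝ n k).eval t * (t - x) ^ (s - 1) := by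
  -- The factor `X * (1 - X)` kills the boundary terms and turns the derivative of the Bernstein
  -- polynomial into a multiple of it.
  have h := integral_eval_derivative (X * (1 - X) * bernsteinPolynomial ℝ n k * (X - C x) ^ s)
  have e : ∀ t : ℝ, (derivative (X * (1 - X) * bernsteinPolynomial ℝ n k * (X - C x) ^ s)).eval t
      = ((k : ℝ) - n * x + (s + 1) * (1 - 2 * x)) *
          ((bernsteinPolynomial ℝ n k).eval t * (t - x) ^ s)
        + s * (x * (1 - x)) * ((bernsteinPolynomial ℝ n k).eval t * (t - x) ^ (s - 1))
        - ((n : ℝ) + 2 + s) * ((bernsteinPolynomial ℝ n k).eval t * (t - x) ^ (s + 1)) := by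
    intro t
    have hb := congrArg (eval t) (X_mul_one_sub_X_mul_derivative_bernstein n k)
    simp only [eval_mul, eval_sub, eval_X, eval_one, eval_natCast] at hb
    rcases s with _ | s
    · simp [derivative_mul]
      linear_combination hb
    · simp [derivative_mul, derivative_pow]
      linear_combination (t - x) ^ (s + 1) * hb
  have hi : ∀ i : ℕ, IntervalIntegrable
      (fun t : ℝ => (bernsteinPolynomial ℝ n k).eval t * (t - x) ^ i)
      MeasureTheory.volume 0 1 := fun i =>
    Continuous.intervalIntegrable (by fun_prop) _ _
  simp only [e] at h
  rw [intervalIntegral.integral_sub (((hi _).const_mul _).add ((hi _).const_mul _))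
      ((hi _).const_mul _),
    intervalIntegral.integral_add ((hi _).const_mul _) ((hi _).const_mul _)] at h
  simp only [intervalIntegral.integral_const_mul] at h
  simp at h
  linarith

theorem integral_bernstein_mul_pow (n k s : ℕ) (hk : k ≤ n) (x : ℝ) :
    (∏ i ∈ Finset.range s, ((n : ℝ) + 2 + i)) * (((n : ℝ) + 1) *
      ∫ t in (0 : ℝ)..1, (bernsteinPolynomial ℝ n k).eval t * (t - x) ^ s)
      = (kernelMoment n k s).eval x := by
  induction s using Nat.twoStepInduction with
  | zero => simpa [kernelMoment] using integral_bernstein n k hk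
  | one =>
    have h := integral_bernstein_mul_pow_succ n k 0 x
    have h0 := integral_bernstein n k hk
    simp [kernelMoment] at h ⊢
    linear_combination ((n : ℝ) + 1) * h + ((k : ℝ) - n * x + (1 - 2 * x)) * h0
  | more s ih1 ih2 =>
    have h := integral_bernstein_mul_pow_succ n k (s + 1) x
    rw [Nat.add_sub_cancel] at h
    simp only [kernelMoment, eval_add, eval_mul, eval_sub, eval_C, eval_X, eval_natCast,
      eval_ofNat, eval_one, ← ih1, ← ih2]
    rw [Finset.prod_range_succ] at ih2 ⊢
    rw [Finset.prod_range_succ]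
    push_cast at h ⊢
    linear_combination ((n : ℝ) + 1) * (∏ i ∈ Finset.range s, ((n : ℝ) + 2 + i))
      * ((n : ℝ) + 2 + s) * h

/-! ### Shifted Durrmeyer operators and the decomposition of the operator -/

/-- The Bernstein–Durrmeyer type operator of degree `m + 4` whose outer Bernstein basis has
degree `m` and is shifted by `j`. -/
noncomputable def shiftedDurrmeyer (m j : ℕ) (x : ℝ) (g : ℝ → ℝ) : ℝ :=
  ((m : ℝ) + 5) * ∑ l ∈ Finset.range (m + 1), (bernsteinPolynomial ℝ m l).eval x *
    ∫ t in (0 : ℝ)..1, (bernsteinPolynomial ℝ (m + 4) (l + j)).eval t * g t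

theorem shiftedDurrmeyer_pow (m j s : ℕ) (hj : j ≤ 4) (x : ℝ) :
    (∏ i ∈ Finset.range s, ((m : ℝ) + 4 + 2 + i)) *
      shiftedDurrmeyer m j x (fun t => (t - x) ^ s)
      = (shiftedMoment ((m : ℝ) + 4) j s).eval x := by
  rw [← sum_bernstein_mul_kernelMoment, eval_finsetSum, shiftedDurrmeyer, ← mul_assoc,
    Finset.mul_sum]
  refine Finset.sum_congr rfl fun l hl => ?_
  have h := integral_bernstein_mul_pow (m + 4) (l + j) s
    (by have := Finset.mem_range.mp hl; omega) x
  push_cast at h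
  rw [eval_mul, ← h]
  ring

theorem shiftedDurrmeyer_add (m j : ℕ) (x : ℝ) {g h : ℝ → ℝ}
    (hg : ContinuousOn g (Set.Icc 0 1)) (hh : ContinuousOn h (Set.Icc 0 1)) :
    shiftedDurrmeyer m j x (fun t => g t + h t)
      = shiftedDurrmeyer m j x g + shiftedDurrmeyer m j x h := by
  have hi : ∀ (k : ℕ) {g : ℝ → ℝ}, ContinuousOn g (Set.Icc 0 1) → IntervalIntegrable
      (fun t : ℝ => (bernsteinPolynomial ℝ (m + 4) k).eval t * g t)
      MeasureTheory.volume 0 1 := fun k g hg => by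
    refine ContinuousOn.intervalIntegrable ?_
    rw [Set.uIcc_of_le zero_le_one]
    exact (Polynomial.continuous _).continuousOn.mul hg
  simp only [shiftedDurrmeyer, mul_add, intervalIntegral.integral_add (hi _ hg) (hi _ hh),
    Finset.sum_add_distrib]

theorem shiftedDurrmeyer_const_mul (m j : ℕ) (x c : ℝ) (g : ℝ → ℝ) :
    shiftedDurrmeyer m j x (fun t => c * g t) = c * shiftedDurrmeyer m j x g := by
  simp only [shiftedDurrmeyer, Finset.mul_sum, ← intervalIntegral.integral_const_mul]
  refine Finset.sum_congr rfl fun l _ => ?_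
  exact intervalIntegral.integral_congr fun t _ => by ring

theorem shiftedDurrmeyer_sum (m j : ℕ) (x : ℝ) (N : ℕ) (a : ℕ → ℝ) {g : ℕ → ℝ → ℝ}
    (hg : ∀ s, ContinuousOn (g s) (Set.Icc 0 1)) :
    shiftedDurrmeyer m j x (fun t => ∑ s ∈ Finset.range N, a s * g s t)
      = ∑ s ∈ Finset.range N, a s * shiftedDurrmeyer m j x (g s) := by
  induction N with
  | zero => simp [shiftedDurrmeyer]
  | succ N ih =>
    simp only [Finset.sum_range_succ]
    rw [shiftedDurrmeyer_add m j x (g := fun t => ∑ s ∈ Finset.range N, a s * g s t)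
      (h := fun t => a N * g N t) (continuousOn_finsetSum _ fun s _ =>
      continuousOn_const.mul (hg s)) (continuousOn_const.mul (hg N)), ih,
      shiftedDurrmeyer_const_mul]

theorem bernstein_eval_nonneg (n k : ℕ) {t : ℝ} (ht : t ∈ Set.Icc (0 : ℝ) 1) :
    0 ≤ (bernsteinPolynomial ℝ n k).eval t := by
  have h0 := ht.1
  have h1 : 0 ≤ 1 - t := sub_nonneg.mpr ht.2
  simp only [bernsteinPolynomial, eval_mul, eval_natCast, eval_pow, eval_X, eval_sub, eval_one]
  positivity

theorem abs_shiftedDurrmeyer_le (m j : ℕ) {x : ℝ} (hx : x ∈ Set.Icc (0 : ℝ) 1) {g h : ℝ → ℝ}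
    (hh : ContinuousOn h (Set.Icc 0 1)) (hgh : ∀ t ∈ Set.Icc (0 : ℝ) 1, |g t| ≤ h t) :
    |shiftedDurrmeyer m j x g| ≤ shiftedDurrmeyer m j x h := by
  rw [shiftedDurrmeyer, shiftedDurrmeyer, abs_mul, abs_of_nonneg (by positivity : (0 : ℝ) ≤ m + 5)]
  refine mul_le_mul_of_nonneg_left ((Finset.abs_sum_le_sum_abs _ _).trans
    (Finset.sum_le_sum fun l _ => ?_)) (by positivity)
  rw [abs_mul, abs_of_nonneg (bernstein_eval_nonneg m l hx)]
  refine mul_le_mul_of_nonneg_left ?_ (bernstein_eval_nonneg m l hx)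
  rw [← Real.norm_eq_abs]
  refine intervalIntegral.norm_integral_le_of_norm_le zero_le_one
    (Filter.Eventually.of_forall fun t ht => ?_) ?_
  · have ht' := Set.Ioc_subset_Icc_self ht
    rw [Real.norm_eq_abs, abs_mul, abs_of_nonneg (bernstein_eval_nonneg _ _ ht')]
    exact mul_le_mul_of_nonneg_left (hgh t ht') (bernstein_eval_nonneg _ _ ht')
  · refine ContinuousOn.intervalIntegrable ?_
    rw [Set.uIcc_of_le zero_le_one]
    exact (Polynomial.continuous _).continuousOn.mul hh

/-- The five coefficients in the weights of the operator. -/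
noncomputable def tildeCoeff (n : ℕ) (x : ℝ) : Fin 5 → ℝ :=
  ![bTilde x n, dTilde x n, eTilde x n, dTilde (1 - x) n, bTilde (1 - x) n]

theorem p_natCast (m k : ℕ) (x : ℝ) :
    p (m : ℤ) (k : ℤ) x = (bernsteinPolynomial ℝ m k).eval x := by
  rw [p]
  split_ifs with h
  · simp
  · rw [bernsteinPolynomial.eq_zero_of_lt ℝ (by omega : m < k), eval_zero]

theorem sum_p_shift (m j : ℕ) (hj : j ≤ 4) (x : ℝ) (v : ℕ → ℝ) :
    ∑ k ∈ Finset.range (m + 5), p (m : ℤ) ((k : ℤ) - j) x * v k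
      = ∑ l ∈ Finset.range (m + 1), (bernsteinPolynomial ℝ m l).eval x * v (l + j) := by
  rw [show m + 5 = j + ((m + 1) + (4 - j)) by omega, Finset.sum_range_add, Finset.sum_range_add,
    Finset.sum_eq_zero, Finset.sum_eq_zero (s := Finset.range (4 - j)), zero_add, add_zero]
  · refine Finset.sum_congr rfl fun l _ => ?_
    rw [show (((j + l : ℕ) : ℤ) - j) = (l : ℤ) by push_cast; ring, p_natCast, add_comm j l]
  · intro l _
    rw [p, if_neg (by push_cast; omega), zero_mul]
  · intro l hl
    have := Finset.mem_range.mp hl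
    rw [p, if_neg (by omega), zero_mul]

theorem durrmeyerTilde3_eq_sum (m : ℕ) (f : ℝ → ℝ) (x : ℝ) :
    durrmeyerTilde3 (m + 4) f x
      = ∑ j : Fin 5, tildeCoeff (m + 4) x j * shiftedDurrmeyer m j x f := by
  have h : ∀ j : ℕ, j ≤ 4 → shiftedDurrmeyer m j x f = ((m : ℝ) + 5) *
      ∑ k ∈ Finset.range (m + 5), p (m : ℤ) ((k : ℤ) - j) x *
        ∫ t in (0 : ℝ)..1, p ((m + 4 : ℕ) : ℤ) (k : ℤ) t * f t := fun j hj => by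
    rw [sum_p_shift m j hj, shiftedDurrmeyer]
    simp only [p_natCast]
  have e : ((m + 4 : ℕ) : ℤ) - 4 = m := by push_cast; ring
  have h0 := h 0 (by omega)
  have h1 := h 1 (by omega)
  have h2 := h 2 (by omega)
  have h3 := h 3 (by omega)
  have h4 := h 4 (by omega)
  simp only [Nat.cast_zero, sub_zero, Nat.cast_one, Nat.cast_ofNat] at h0 h1 h2 h3 h4
  simp only [durrmeyerTilde3, durrmeyer3, weight, e, Fin.sum_univ_five, tildeCoeff]
  simp only [Fin.isValue, Matrix.cons_val, Fin.coe_ofNat_eq_mod, Nat.zero_mod, Nat.one_mod,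
    Nat.reduceMod, h0, h1, h2, h3, h4, Finset.mul_sum, ← Finset.sum_add_distrib]
  refine Finset.sum_congr rfl fun k _ => ?_
  push_cast
  ring

/-! ### Cancellation among the five coefficients -/

/-- Newton's forward form of the combination: the coefficients of the differences of order 0 to 4
have degrees 0, 0, 1, 1, 2 in `n`, although each original coefficient has size up to `n^2`. -/
theorem sum_tildeCoeff_mul_shiftedMoment (n s : ℕ) (x : ℝ) :
    ∑ j : Fin 5, tildeCoeff n x j * (shiftedMoment n j s).eval x
      = (momentDiff n s 0 0).eval x + (6 * x - 1) * (momentDiff n s 1 0).eval x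
        + (x ^ 2 * n - x * n + 17 * x ^ 2 - 8 * x + 1) * (momentDiff n s 2 0).eval x
        + ((6 * x ^ 3 - 8 * x ^ 2 + 2 * x) * n + 32 * x ^ 3 - 31 * x ^ 2 + 10 * x - 1)
          * (momentDiff n s 3 0).eval x
        + bTilde (1 - x) n * (momentDiff n s 4 0).eval x := by
  simp only [Fin.sum_univ_five, tildeCoeff, momentDiff, eval_sub, bTilde, dTilde, eTilde]
  simp only [Fin.isValue, Matrix.cons_val, Fin.coe_ofNat_eq_mod, Nat.zero_mod, Nat.one_mod,
    Nat.reduceMod, Nat.reduceAdd, zero_add]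
  ring

theorem isBigO_const_natCast_zpow (c : ℝ) {d : ℤ} (hd : 0 ≤ d) :
    (fun _ : ℕ => c) =O[atTop] fun n => (n : ℝ) ^ d := by
  simpa using (PolyGrowth.const (C c) hd).eval 0

theorem isBigO_natCast_zpow_mul {a b : ℕ → ℝ} {d e : ℤ} (ha : a =O[atTop] fun n => (n : ℝ) ^ d)
    (hb : b =O[atTop] fun n => (n : ℝ) ^ e) {c : ℤ} (hc : d + e = c) :
    (fun n => a n * b n) =O[atTop] fun n => (n : ℝ) ^ c := by
  refine (ha.mul hb).congr' EventuallyEq.rfl ?_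
  filter_upwards [eventually_ne_atTop 0] with n hn
  rw [← hc, zpow_add₀ (Nat.cast_ne_zero.mpr hn)]

theorem isBigO_linear (u v : ℝ) :
    (fun n : ℕ => u * (n : ℝ) + v) =O[atTop] fun n => (n : ℝ) ^ (1 : ℤ) := by
  refine IsBigO.add ?_ (isBigO_const_natCast_zpow v zero_le_one)
  simpa using (isBigO_natCast_add_const 0).const_mul_left u

theorem isBigO_quadratic (u v w : ℝ) :
    (fun n : ℕ => u * (n : ℝ) ^ 2 + v * n + w) =O[atTop] fun n => (n : ℝ) ^ (2 : ℤ) := by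
  have h := (isBigO_natCast_zpow_mul (isBigO_linear u v) (isBigO_linear 1 0)
    (by norm_num : (1 : ℤ) + 1 = 2)).add (isBigO_const_natCast_zpow w zero_le_two)
  exact h.congr_left fun n => by ring

theorem isBigO_bTilde (x : ℝ) :
    (fun n : ℕ => bTilde x n) =O[atTop] fun n => (n : ℝ) ^ (2 : ℤ) :=
  (isBigO_quadratic (1 / 2 * x ^ 4 - x ^ 3 + 1 / 2 * x ^ 2)
    (-3 * x ^ 3 + 29 / 6 * x ^ 2 - 11 / 6 * x)
    (-16 * x ^ 3 + 89 / 3 * x ^ 2 - 53 / 3 * x + 10 / 3)).congr_left fun n => by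
      rw [bTilde]; ring

theorem isBigO_dTilde (x : ℝ) :
    (fun n : ℕ => dTilde x n) =O[atTop] fun n => (n : ℝ) ^ (2 : ℤ) :=
  (isBigO_quadratic (-2 * x ^ 4 + 4 * x ^ 3 - 2 * x ^ 2)
    (6 * x ^ 3 - 28 / 3 * x ^ 2 + 10 / 3 * x)
    (32 * x ^ 3 - 161 / 3 * x ^ 2 + 80 / 3 * x - 10 / 3)).congr_left fun n => by
      rw [dTilde]; ring

theorem isBigO_eTilde (x : ℝ) :
    (fun n : ℕ => eTilde x n) =O[atTop] fun n => (n : ℝ) ^ (2 : ℤ) :=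
  (isBigO_quadratic (3 * (x * (1 - x)) ^ 2) 0 0).congr_left fun n => by
      rw [eTilde]; ring

theorem isBigO_tildeCoeff (x : ℝ) (j : Fin 5) :
    (fun n : ℕ => tildeCoeff n x j) =O[atTop] fun n => (n : ℝ) ^ (2 : ℤ) := by
  fin_cases j
  · exact isBigO_bTilde x
  · exact isBigO_dTilde x
  · exact isBigO_eTilde x
  · exact isBigO_dTilde (1 - x)
  · exact isBigO_bTilde (1 - x)

theorem isBigO_sum_tildeCoeff_mul_shiftedMoment (s : ℕ) (x : ℝ) (d : ℤ) (h : (s : ℤ) ≤ 2 * d + 1) :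
    (fun n : ℕ => ∑ j : Fin 5, tildeCoeff n x j * (shiftedMoment n j s).eval x)
      =O[atTop] fun n => (n : ℝ) ^ d := by
  simp only [sum_tildeCoeff_mul_shiftedMoment]
  have g : ∀ (r : ℕ) (e : ℤ), (s : ℤ) ≤ r + 2 * e + 1 →
      (fun n : ℕ => (momentDiff n s r 0).eval x) =O[atTop] fun n => (n : ℝ) ^ e :=
    fun r e he => (polyGrowth_momentDiff s r 0 e he).eval x
  refine ((((g 0 d (by push_cast; omega)).add
    ((g 1 d (by push_cast; omega)).const_mul_left _)).add ?_).add ?_).add ?_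
  · refine isBigO_natCast_zpow_mul (d := 1) (e := d - 1) ?_ (g 2 _ (by push_cast; omega)) (by ring)
    exact (isBigO_linear (x ^ 2 - x) (17 * x ^ 2 - 8 * x + 1)).congr_left fun n => by ring
  · refine isBigO_natCast_zpow_mul (d := 1) (e := d - 1) ?_ (g 3 _ (by push_cast; omega)) (by ring)
    exact (isBigO_linear (6 * x ^ 3 - 8 * x ^ 2 + 2 * x)
      (32 * x ^ 3 - 31 * x ^ 2 + 10 * x - 1)).congr_left fun n => by ring
  · exact isBigO_natCast_zpow_mul (d := 2) (e := d - 2) (isBigO_bTilde (1 - x))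
      (g 4 _ (by push_cast; omega)) (by ring)

theorem sum_tildeCoeff_mul_shiftedMoment_zero (n : ℕ) (x : ℝ) :
    ∑ j : Fin 5, tildeCoeff n x j * (shiftedMoment n j 0).eval x = 1 := by
  simp [Fin.sum_univ_five, tildeCoeff, shiftedMoment, bTilde, dTilde, eTilde]
  ring

theorem sum_tildeCoeff_mul_shiftedMoment_one (n : ℕ) (x : ℝ) :
    ∑ j : Fin 5, tildeCoeff n x j * (shiftedMoment n j 1).eval x = 0 := by
  simp [Fin.sum_univ_five, tildeCoeff, shiftedMoment, bTilde, dTilde, eTilde]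
  ring

theorem sum_tildeCoeff_mul_shiftedMoment_two (n : ℕ) (x : ℝ) :
    ∑ j : Fin 5, tildeCoeff n x j * (shiftedMoment n j 2).eval x = 0 := by
  simp [Fin.sum_univ_five, tildeCoeff, shiftedMoment, bTilde, dTilde, eTilde]
  ring

theorem sum_tildeCoeff_mul_shiftedMoment_three (n : ℕ) (x : ℝ) :
    ∑ j : Fin 5, tildeCoeff n x j * (shiftedMoment n j 3).eval x = 0 := by
  simp [Fin.sum_univ_five, tildeCoeff, shiftedMoment, bTilde, dTilde, eTilde]
  ring

theorem sum_tildeCoeff_mul_shiftedMoment_four (n : ℕ) (x : ℝ) :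
    ∑ j : Fin 5, tildeCoeff n x j * (shiftedMoment n j 4).eval x
      = (-420 * x ^ 4 + 840 * x ^ 3 - 520 * x ^ 2 + 100 * x) * n
        + (-1152 * x ^ 4 + 2304 * x ^ 3 - 1592 * x ^ 2 + 440 * x - 40) := by
  simp [Fin.sum_univ_five, tildeCoeff, shiftedMoment, bTilde, dTilde, eTilde]
  ring

/-- Except for the moment of order zero, which is `1`, the central moments up to order nine are
`O(n^{-3})` after division by `n^s`. -/
theorem isBigO_sum_tildeCoeff_mul_shiftedMoment_sub (s : ℕ) (hs : s < 10) (x : ℝ) :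
    (fun n : ℕ => ∑ j : Fin 5, tildeCoeff n x j * (shiftedMoment n j s).eval x
      - if s = 0 then 1 else 0) =O[atTop] fun n => (n : ℝ) ^ ((s : ℤ) - 3) := by
  rcases le_or_gt 5 s with h | h
  · simp only [if_neg (by omega : s ≠ 0), sub_zero]
    exact isBigO_sum_tildeCoeff_mul_shiftedMoment s x _ (by omega)
  · interval_cases s
    · simp [sum_tildeCoeff_mul_shiftedMoment_zero, isBigO_zero]
    · simp [sum_tildeCoeff_mul_shiftedMoment_one, isBigO_zero]
    · simp [sum_tildeCoeff_mul_shiftedMoment_two, isBigO_zero]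
    · simp only [sum_tildeCoeff_mul_shiftedMoment_three, if_neg (by norm_num : (3 : ℕ) ≠ 0),
        sub_zero]
      exact isBigO_zero _ _
    · simp only [sum_tildeCoeff_mul_shiftedMoment_four, if_neg (by norm_num : (4 : ℕ) ≠ 0),
        sub_zero]
      exact isBigO_linear _ _

/-! ### Moments of the operator and the Taylor remainder -/

theorem isBigO_inv_prod (s : ℕ) :
    (fun n : ℕ => (∏ i ∈ Finset.range s, ((n : ℝ) + 2 + i))⁻¹)
      =O[atTop] fun n => (n : ℝ) ^ (-(s : ℤ)) := by
  refine IsBigO.of_bound 1 ?_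
  filter_upwards [eventually_ge_atTop 1] with n hn
  have hn' : (0 : ℝ) < n := by exact_mod_cast hn
  rw [one_mul, zpow_neg, zpow_natCast, norm_inv, norm_inv,
    Real.norm_of_nonneg (Finset.prod_nonneg fun i _ => by positivity),
    Real.norm_of_nonneg (by positivity)]
  refine inv_anti₀ (by positivity) ?_
  calc (n : ℝ) ^ s = ∏ i ∈ Finset.range s, (n : ℝ) := by simp
    _ ≤ _ := Finset.prod_le_prod (fun _ _ => hn'.le) fun i _ => by
      have : (0 : ℝ) ≤ i := Nat.cast_nonneg i
      linarith

theorem durrmeyerTilde3_eventually_eq (x : ℝ) : ∀ᶠ n : ℕ in atTop, ∀ f : ℝ → ℝ,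
    durrmeyerTilde3 n f x = ∑ j : Fin 5, tildeCoeff n x j * shiftedDurrmeyer (n - 4) j x f := by
  filter_upwards [eventually_ge_atTop 4] with n hn f
  obtain ⟨m, rfl⟩ := Nat.exists_eq_add_of_le' hn
  rw [Nat.add_sub_cancel, durrmeyerTilde3_eq_sum]

theorem shiftedDurrmeyer_pow_eq_inv_mul {n : ℕ} (hn : 4 ≤ n) (j : Fin 5) (s : ℕ) (x : ℝ) :
    shiftedDurrmeyer (n - 4) j x (fun t => (t - x) ^ s)
      = (∏ i ∈ Finset.range s, ((n : ℝ) + 2 + i))⁻¹ * (shiftedMoment n j s).eval x := by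
  obtain ⟨m, rfl⟩ := Nat.exists_eq_add_of_le' hn
  have hp : (∏ i ∈ Finset.range s, ((m : ℝ) + 4 + 2 + i)) ≠ 0 :=
    (Finset.prod_pos fun i _ => by positivity).ne'
  rw [Nat.add_sub_cancel]
  push_cast
  rw [← shiftedDurrmeyer_pow m j s (by omega), inv_mul_cancel_left₀ hp]

theorem isBigO_durrmeyerTilde3_pow (s : ℕ) (hs : s < 10) (x : ℝ) :
    (fun n : ℕ => durrmeyerTilde3 n (fun t => (t - x) ^ s) x - if s = 0 then 1 else 0)
      =O[atTop] fun n => (n : ℝ) ^ (-3 : ℤ) := by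
  refine (isBigO_natCast_zpow_mul (isBigO_inv_prod s)
    (isBigO_sum_tildeCoeff_mul_shiftedMoment_sub s hs x) (by ring)).congr' ?_ EventuallyEq.rfl
  filter_upwards [durrmeyerTilde3_eventually_eq x, eventually_ge_atTop 4] with n hn h4
  rw [hn]
  simp only [shiftedDurrmeyer_pow_eq_inv_mul h4, mul_sub, Finset.mul_sum]
  congr 1
  · exact Finset.sum_congr rfl fun j _ => by ring
  · split_ifs with h
    · simp [h]
    · simp

theorem isBigO_durrmeyerTilde3_of_abs_le {x : ℝ} (hx : x ∈ Set.Icc (0 : ℝ) 1) {R : ℝ → ℝ} {K : ℝ}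
    (hR : ∀ t ∈ Set.Icc (0 : ℝ) 1, |R t| ≤ K * (t - x) ^ 10) :
    (fun n : ℕ => durrmeyerTilde3 n R x) =O[atTop] fun n => (n : ℝ) ^ (-3 : ℤ) := by
  have h : ∀ j : Fin 5, (fun n : ℕ => tildeCoeff n x j * shiftedDurrmeyer (n - 4) j x R)
      =O[atTop] fun n => (n : ℝ) ^ (-3 : ℤ) := by
    intro j
    -- No cancellation is used here: the tenth moment is `n^5 · n^{-10}`, and the coefficient costs
    -- `n^2`.
    refine isBigO_natCast_zpow_mul (e := -5) (isBigO_tildeCoeff x j) ?_ (by norm_num)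
    have h10 := isBigO_natCast_zpow_mul (c := -5) (isBigO_inv_prod 10)
      ((polyGrowth_momentDiff 10 0 j 5 (by norm_num)).eval x) (by norm_num)
    refine IsBigO.trans (IsBigO.of_bound |K| ?_) h10
    filter_upwards [eventually_ge_atTop 4] with n hn
    have := abs_shiftedDurrmeyer_le (n - 4) j hx (h := fun t => K * (t - x) ^ 10)
      (by fun_prop) hR
    rw [shiftedDurrmeyer_const_mul, shiftedDurrmeyer_pow_eq_inv_mul hn] at this
    rw [Real.norm_eq_abs, Real.norm_eq_abs, ← abs_mul]
    exact this.trans (le_abs_self _)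
  refine (IsBigO.fun_sum fun j (_ : j ∈ Finset.univ) => h j).congr' ?_ EventuallyEq.rfl
  filter_upwards [durrmeyerTilde3_eventually_eq x] with n hn
  rw [hn]

/-- Taylor's theorem on a compact interval, with a base point anywhere in the interval. -/
theorem exists_abs_sub_taylor_le {f : ℝ → ℝ} {a b : ℝ} (hab : a < b) {n : ℕ}
    (hf : ContDiffOn ℝ (n + 1) f (Set.Icc a b)) {x : ℝ} (hx : x ∈ Set.Icc a b) :
    ∃ K, ∀ t ∈ Set.Icc a b,
      |f t - taylorWithinEval f n (Set.Icc a b) x t| ≤ K * |t - x| ^ (n + 1) := by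
  have hu := uniqueDiffOn_Icc hab
  obtain ⟨K, hK⟩ := isCompact_Icc.exists_bound_of_continuousOn
    (hf.continuousOn_iteratedDerivWithin (m := n + 1) (by norm_cast) hu)
  have hf' : DifferentiableOn ℝ (iteratedDerivWithin n f (Set.Icc a b)) (Set.Icc a b) :=
    hf.differentiableOn_iteratedDerivWithin (mod_cast n.lt_succ_self) hu
  refine ⟨(n.factorial : ℝ)⁻¹ * K, fun t ht => ?_⟩
  have hsub : Set.uIcc x t ⊆ Set.Icc a b := Set.uIcc_subset_Icc hx ht
  -- Mean value inequality in the base point `y`: at `y = t` the Taylor polynomial equals `f t`, and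
  -- its `y`-derivative is a single term, `(t-y)^n / n!` times the derivative of order `n+1`.
  have h := (convex_uIcc x t).norm_image_sub_le_of_norm_hasDerivWithin_le
    (f := fun y => taylorWithinEval f n (Set.Icc a b) y t)
    (C := (n.factorial : ℝ)⁻¹ * |t - x| ^ n * K)
    (fun y hy => (hasDerivWithinAt_taylorWithinEval_at_Icc t hab (hsub hy) hf.of_succ hf').mono
      hsub) (fun y hy => ?_) Set.left_mem_uIcc Set.right_mem_uIcc
  · rw [taylorWithinEval_self, Real.norm_eq_abs, Real.norm_eq_abs] at h
    refine h.trans_eq ?_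
    ring
  · rw [norm_smul, Real.norm_eq_abs, abs_mul, abs_inv, Nat.abs_cast, abs_pow]
    have h1 : |t - y| ≤ |t - x| := Set.abs_sub_right_of_mem_uIcc hy
    gcongr
    exact hK y (hsub hy)

end DurrmeyerIII

theorem mainTheorem3 (f : ℝ → ℝ) (hf : ContDiffOn ℝ 10 f (Set.Icc 0 1))
    (x : ℝ) (hx : x ∈ Set.Icc (0 : ℝ) 1) :
    (fun n : ℕ => DurrmeyerIII.durrmeyerTilde3 n f x - f x)
      =O[atTop] (fun n : ℕ => 1 / (n : ℝ) ^ 3) := by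
  obtain ⟨K, hK⟩ := DurrmeyerIII.exists_abs_sub_taylor_le (n := 9) zero_lt_one
    (by exact_mod_cast hf) hx
  set a : ℕ → ℝ := fun s => ((s.factorial : ℝ)⁻¹ * iteratedDerivWithin s f (Set.Icc 0 1) x)
  set R : ℝ → ℝ := fun t => f t - ∑ s ∈ Finset.range 10, a s * (t - x) ^ s with hRdef
  have hR : ∀ t ∈ Set.Icc (0 : ℝ) 1, |R t| ≤ K * (t - x) ^ 10 := by
    intro t ht
    have h := hK t ht
    rw [taylor_within_apply, (by decide : Even (9 + 1)).pow_abs] at h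
    convert h using 3
    exact Finset.sum_congr rfl fun s _ => by simp only [a, smul_eq_mul]; ring
  have hcont : ∀ s : ℕ, ContinuousOn (fun t : ℝ => (t - x) ^ s) (Set.Icc 0 1) := fun s => by
    fun_prop
  have hRc : ContinuousOn R (Set.Icc 0 1) :=
    hf.continuousOn.sub (continuousOn_finsetSum _ fun s _ => continuousOn_const.mul (hcont s))
  have ha0 : a 0 = f x := by simp [a]
  have hsum := (IsBigO.fun_sum fun s (hs : s ∈ Finset.range 10) =>
    (DurrmeyerIII.isBigO_durrmeyerTilde3_pow s (Finset.mem_range.mp hs) x).const_mul_left (a s)).add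
      (DurrmeyerIII.isBigO_durrmeyerTilde3_of_abs_le hx hR)
  refine hsum.congr' ?_ (Eventually.of_forall fun n => ?_)
  · filter_upwards [DurrmeyerIII.durrmeyerTilde3_eventually_eq x] with n hn
    -- By linearity the error splits into moment errors, where only `s = 0` contributes `f x`, plus
    -- the remainder.
    have hf_eq : f = fun t => (∑ s ∈ Finset.range 10, a s * (t - x) ^ s) + R t := by
      funext t
      simp [hRdef]
    have hj : ∀ j : ℕ, DurrmeyerIII.shiftedDurrmeyer (n - 4) j x f
        = ∑ s ∈ Finset.range 10, a s *
            DurrmeyerIII.shiftedDurrmeyer (n - 4) j x (fun t => (t - x) ^ s)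
          + DurrmeyerIII.shiftedDurrmeyer (n - 4) j x R := by
      intro j
      rw [← DurrmeyerIII.shiftedDurrmeyer_sum _ _ _ _ _ hcont,
        ← DurrmeyerIII.shiftedDurrmeyer_add _ _ _
          (g := fun t => ∑ s ∈ Finset.range 10, a s * (t - x) ^ s) (continuousOn_finsetSum _ fun s _ => continuousOn_const.mul (hcont s)) hRc]
      exact congrArg _ hf_eq
    simp only [hn, hj, mul_add, mul_sub, Finset.sum_add_distrib, Finset.sum_sub_distrib,
      Finset.mul_sum]
    rw [Finset.sum_comm]
    have h0 : ∑ s ∈ Finset.range 10, a s * (if s = 0 then 1 else 0) = f x := by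
      simp [ha0]
    rw [h0]
    simp only [mul_left_comm (a _)]
    ring
  · change (n : ℝ) ^ (-3 : ℤ) = 1 / (n : ℝ) ^ 3
    rw [zpow_neg, one_div]
    norm_cast
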